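/- Let $G=(V,E)$ be a finite simple graph and let $M$ be a matching in $G$. A vertex is unmatched if no edge of $M$ covers it. An alternating path is a path (without repeated vertices) such that, of any two consecutive edges on it, exactly one lies in $M$; an augmenting path is an alternating path that joins two distinct unmatched vertices. Lengths are numbers of edges. Let $l_m$ be the length of a shortest augmenting path, with $l_m=\infty$ if there is none. For a vertex $v$, let $\mathrm{evenlevel}(v)$ (respectively $\mathrm{oddlevel}(v)$) be the minimum length of an alternating path of even (respectively odd) length from some unmatched vertex to $v$, and $\infty$ if there is no such path; the paths that attain this minimum are the $\mathrm{evenlevel}(v)$ (respectively $\mathrm{oddlevel}(v)$) paths. The tenacity of $v$ is $\mathrm{evenlevel}(v)+\mathrm{oddlevel}(v)$. Theorem. Let $v$ be a vertex of tenacity $t<l_m$. Every $\mathrm{evenlevel}(v)$ or $\mathrm{oddlevel}(v)$ path $p$ contains a vertex of tenacity greater than $t$; let $F(p,v)$ be the one among these vertices of $p$ that is furthest along $p$ from the unmatched vertex at which $p$ starts. Then the set $$B=\{F(p,v) : p \text{ is an } \mathrm{evenlevel}(v) \text{ or } \mathrm{oddlevel}(v) \text{ path}\}$$ is a singleton. (Its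 only element is called the base of $v$.) -/

import Mathlib

namespace AltPath

variable {V : Type*} {G : SimpleGraph V}

/-- A vertex is unmatched when no edge of the matching `M` covers it. -/
def Unmatched (M : G.Subgraph) (v : V) : Prop := v ∉ M.support

/-- An alternating path: a path without repeated vertices in which, of any two consecutive
edges, exactly one belongs to `M`. -/
def IsAlternatingPath (M : G.Subgraph) {u v : V} (p : G.Walk u v) : Prop :=
  p.IsPath ∧ p.edges.IsChain (fun e e' => e ∈ M.edgeSet ↔ e' ∉ M.edgeSet)

/-- An augmenting path: an alternating path joining two different unmatched vertices. -/
def IsAugmentingPath (M : G.Subgraph) {u v : V} (p : G.Walk u v) : Prop :=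
  IsAlternatingPath M p ∧ Unmatched M u ∧ Unmatched M v ∧ u ≠ v

/-- The length `l_m` of a shortest augmenting path; it is `⊤` if there is none. -/
noncomputable def minAugLength (M : G.Subgraph) : ℕ∞ :=
  sInf {k : ℕ∞ | ∃ (u v : V) (p : G.Walk u v), IsAugmentingPath M p ∧ k = p.length}

/-- The length of a shortest alternating path of even length from an unmatched vertex to `v`;
it is `⊤` if there is none. -/
noncomputable def evenlevel (M : G.Subgraph) (v : V) : ℕ∞ :=
  sInf {k : ℕ∞ | ∃ (f : V) (p : G.Walk f v),
    Unmatched M f ∧ IsAlternatingPath M p ∧ Even p.length ∧ k = p.length}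

/-- The length of a shortest alternating path of odd length from an unmatched vertex to `v`;
it is `⊤` if there is none. -/
noncomputable def oddlevel (M : G.Subgraph) (v : V) : ℕ∞ :=
  sInf {k : ℕ∞ | ∃ (f : V) (p : G.Walk f v),
    Unmatched M f ∧ IsAlternatingPath M p ∧ Odd p.length ∧ k = p.length}

/-- `p` is an `evenlevel(v)` path. -/
def IsEvenlevelPath (M : G.Subgraph) {f v : V} (p : G.Walk f v) : Prop :=
  Unmatched M f ∧ IsAlternatingPath M p ∧ Even p.length ∧ (p.length : ℕ∞) = evenlevel M v

/-- `p` is an `oddlevel(v)` path. -/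
def IsOddlevelPath (M : G.Subgraph) {f v : V} (p : G.Walk f v) : Prop :=
  Unmatched M f ∧ IsAlternatingPath M p ∧ Odd p.length ∧ (p.length : ℕ∞) = oddlevel M v

/-- The tenacity of a vertex. -/
noncomputable def tenacity (M : G.Subgraph) (v : V) : ℕ∞ := evenlevel M v + oddlevel M v

/-- `IsBaseOn M p b` says that `b` is `F(p, v)`, where `v` is the end of `p`: among the vertices
of `p` of tenacity greater than that of `v`, `b` is the one furthest from the start of `p`. -/
def IsBaseOn (M : G.Subgraph) {f v : V} (p : G.Walk f v) (b : V) : Prop :=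
  ∃ i ≤ p.length, p.getVert i = b ∧ tenacity M v < tenacity M b ∧
    ∀ j ≤ p.length, tenacity M v < tenacity M (p.getVert j) → j ≤ i

/-- The set of all `F(p, v)`, where `p` runs over the `evenlevel(v)` and the `oddlevel(v)` paths. -/
def baseSet (M : G.Subgraph) (v : V) : Set V :=
  {b | ∃ (f : V) (p : G.Walk f v), (IsEvenlevelPath M p ∨ IsOddlevelPath M p) ∧ IsBaseOn M p b}

end AltPath

/-!
The tenacity of an unmatched edge `uv` is `evenlevel u + evenlevel v + 1`, that of a matched edge is
`oddlevel u + oddlevel v + 1`. For `r < l_m`, consider the components of the graph of all edges of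
tenacity at most `r`. They play the role of blossoms: the claim is that each of them has at most one
vertex of tenacity greater than `r` (`singleBase_of_lt`), and that a level path to a vertex `v` of
tenacity `t` contains such a vertex, for `r = t`, in the run of vertices with which it ends in the
component of `v`. Then `F(p, v)` is this vertex for every `p`.

The second assertion follows from the first one by weak duality (`AltSeq.potential_mono`). For a
bound `s`, let the length of an edge be the number of `r < s` for which its ends are in different
components. For potentials that agree with the levels where these matter, this length is at most the
sum of the potentials of the two ends plus one (`sum_crossing_le_potential`). Summing over an
alternating path from an unmatched vertex shows that its length is at least the potential of its end
plus, over all `r < s`, the number of runs of the path inside components that lack a vertex of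
tenacity greater than `r`; this uses that no run has two such vertices. So on a path whose length
equals the potential of its end (a tight path, in particular a level path to a vertex of tenacity at
most `s`) each run has such a vertex (`IsTight.exists_high`), and the path reaches all its vertices
of tenacity at least `s` by tight paths (`IsTight.prefix`).

The first assertion is proved by induction on `r`, using weak duality with `s = r`. It suffices that
tight paths to the same vertex of tenacity at most `s`, or to the two ends of an edge of tenacity at
most `s`, have the same last vertex of tenacity greater than `s` (`IsTight.top_eq`,
`IsTight.top_eq_of_adj`). If these last vertices `b` and `c` differ, with `c` at least as far along
its path as `b`, then one path followed by a part of the other one, traversed backwards, is an odd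
alternating path to `c`, short enough to give `c` tenacity at most `s`; the only obstruction is a
vertex where the paths meet again at the same position (`IsTight.disjoint_or_meet`), and this
is excluded by induction on levels.
-/

namespace AltPath

variable {V : Type*} {G : SimpleGraph V} {M : G.Subgraph}

/-! ### Alternating sequences -/

/-- An alternating path of length `n` from an unmatched vertex, encoded as the function
`i ↦ i`-th vertex (only the values at `0, …, n` matter). As the first edge is not in `M`, the
`i`-th edge is in `M` exactly for odd `i`. -/
structure AltSeq (M : G.Subgraph) (x : ℕ → V) (n : ℕ) : Prop where
  unmatched : Unmatched M (x 0)
  inj : ∀ i ≤ n, ∀ j ≤ n, x i = x j → i = j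
  adj : ∀ i < n, G.Adj (x i) (x (i + 1))
  mem_iff : ∀ i < n, M.Adj (x i) (x (i + 1)) ↔ Odd i

theorem AltSeq.prefix {x : ℕ → V} {n k : ℕ} (h : AltSeq M x n) (hk : k ≤ n) : AltSeq M x k :=
  ⟨h.unmatched, fun i hi j hj => h.inj i (hi.trans hk) j (hj.trans hk),
    fun i hi => h.adj i (hi.trans_le hk), fun i hi => h.mem_iff i (hi.trans_le hk)⟩

/-- The concatenation of an alternating sequence with a disjoint sequence whose edges continue the
alternation. -/
theorem AltSeq.append {x y : ℕ → V} {n l : ℕ} (h : AltSeq M x n)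
    (inj : ∀ i ≤ l, ∀ j ≤ l, y i = y j → i = j)
    (disj : ∀ i ≤ n, ∀ j ≤ l, x i ≠ y j)
    (hadj : G.Adj (x n) (y 0)) (hmem : M.Adj (x n) (y 0) ↔ Odd n)
    (yadj : ∀ i < l, G.Adj (y i) (y (i + 1)))
    (ymem : ∀ i < l, M.Adj (y i) (y (i + 1)) ↔ Odd (n + 1 + i)) :
    AltSeq M (fun k => if k ≤ n then x k else y (k - (n + 1))) (n + 1 + l) := by
  have key : ∀ i < n + 1 + l, i < n ∨ i = n ∨ ∃ j < l, i = n + 1 + j := by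
    intro i hi
    rcases lt_trichotomy i n with h1 | h1 | h1
    · exact Or.inl h1
    · exact Or.inr (Or.inl h1)
    · exact Or.inr (Or.inr ⟨i - (n + 1), by omega, by omega⟩)
  refine ⟨by simpa using h.unmatched, fun i hi j hj hij => ?_, fun i hi => ?_, fun i hi => ?_⟩
  · by_cases h1 : i ≤ n <;> by_cases h2 : j ≤ n <;> simp only [h1, h2, if_true, if_false] at hij
    · exact h.inj i h1 j h2 hij
    · exact absurd hij (disj i h1 _ (by omega))
    · exact absurd hij.symm (disj j h2 _ (by omega))
    · have := inj _ (by omega) _ (by omega) hij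
      omega
  · rcases key i hi with h1 | rfl | ⟨j, hj, rfl⟩
    · simpa [h1.le, Nat.succ_le_of_lt h1] using h.adj i h1
    · simpa using hadj
    · have h1 : ¬ n + 1 + j ≤ n := by omega
      have h2 : ¬ n + 1 + j + 1 ≤ n := by omega
      have h3 : n + 1 + j - (n + 1) = j := by omega
      have h4 : n + 1 + j + 1 - (n + 1) = j + 1 := by omega
      simpa only [h1, h2, if_false, h3, h4] using yadj j hj
  · rcases key i hi with h1 | rfl | ⟨j, hj, rfl⟩
    · simpa [h1.le, Nat.succ_le_of_lt h1] using h.mem_iff i h1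
    · simpa using hmem
    · have h1 : ¬ n + 1 + j ≤ n := by omega
      have h2 : ¬ n + 1 + j + 1 ≤ n := by omega
      have h3 : n + 1 + j - (n + 1) = j := by omega
      have h4 : n + 1 + j + 1 - (n + 1) = j + 1 := by omega
      simpa only [h1, h2, if_false, h3, h4] using ymem j hj

/-- Two alternating sequences whose ends are joined by an edge, traversed along the first one and
then backwards along the second one down to its `j`-th vertex. -/
theorem AltSeq.exists_join {x y : ℕ → V} {n m j : ℕ} (hx : AltSeq M x n) (hy : AltSeq M y m)
    (hj : j ≤ m) (hnm : n % 2 = m % 2) (hadj : G.Adj (x n) (y m))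
    (hmem : M.Adj (x n) (y m) ↔ Odd n)
    (disj : ∀ i ≤ n, ∀ k ≤ m, j ≤ k → x i ≠ y k) :
    ∃ z, AltSeq M z (n + 1 + (m - j)) ∧ z (n + 1 + (m - j)) = y j := by
  refine ⟨_, hx.append (y := fun k => y (m - k)) (l := m - j) ?_ ?_ (by simpa using hadj)
    (by simpa using hmem) ?_ ?_, ?_⟩
  · intro i hi k hk h
    have := hy.inj _ (by omega) _ (by omega) h
    omega
  · intro i hi k hk
    exact disj i hi _ (by omega) (by omega)
  · intro i hi
    have h1 : m - i = m - (i + 1) + 1 := by omega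
    simpa only [h1] using (hy.adj (m - (i + 1)) (by omega)).symm
  · intro i hi
    have h1 : m - i = m - (i + 1) + 1 := by omega
    have h2 : Odd (m - (i + 1)) ↔ Odd (n + 1 + i) := by
      simp only [Nat.odd_iff]; omega
    rw [← h2, ← hy.mem_iff _ (by omega : m - (i + 1) < m), h1]
    exact ⟨fun h => h.symm, fun h => h.symm⟩
  · have h1 : ¬ n + 1 + (m - j) ≤ n := by omega
    have h2 : m - (n + 1 + (m - j) - (n + 1)) = j := by omega
    simp only [h1, if_false, h2]

theorem AltSeq.exists_snoc {x : ℕ → V} {n : ℕ} {w : V} (hx : AltSeq M x n)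
    (hw : ∀ i ≤ n, x i ≠ w) (hadj : G.Adj (x n) w) (hmem : M.Adj (x n) w ↔ Odd n) :
    ∃ z, AltSeq M z (n + 1) ∧ z (n + 1) = w :=
  ⟨_, hx.append (y := fun _ => w) (l := 0) (by omega) (fun i hi _ _ => hw i hi) hadj hmem
    (by omega) (by omega), by simp⟩

theorem mate_unique (hM : M.IsMatching) {u v w : V} (h : M.Adj u v) (h' : M.Adj u w) : v = w :=
  (hM (M.edge_vert h)).unique h h'

/-- A matched edge at an odd position of an alternating sequence leads to the next vertex. -/
theorem AltSeq.mate_of_odd (hM : M.IsMatching) {x : ℕ → V} {n k : ℕ} {v : V} (h : AltSeq M x n)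
    (hk : k < n) (ho : k % 2 = 1) (hv : M.Adj (x k) v) : x (k + 1) = v :=
  mate_unique hM ((h.mem_iff k hk).2 (Nat.odd_iff.2 ho)) hv

/-- A matched edge at an even position of an alternating sequence comes from the previous
vertex. -/
theorem AltSeq.mate_of_even (hM : M.IsMatching) {x : ℕ → V} {n k : ℕ} {v : V} (h : AltSeq M x n)
    (hk : k ≤ n) (he : k % 2 = 0) (hv : M.Adj (x k) v) : 1 ≤ k ∧ x (k - 1) = v := by
  rcases Nat.eq_zero_or_pos k with rfl | hpos
  · exact absurd (M.mem_support.2 ⟨v, hv⟩) h.unmatched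
  · refine ⟨hpos, ?_⟩
    have h1 := (h.mem_iff (k - 1) (by omega)).2 (Nat.odd_iff.2 (by omega))
    rw [Nat.sub_add_cancel hpos] at h1
    exact mate_unique hM h1.symm hv

theorem edges_getElem {u v : V} (p : G.Walk u v) (i : ℕ) (hi : i < p.edges.length) :
    p.edges[i] = s(p.getVert i, p.getVert (i + 1)) := by
  induction p generalizing i with
  | nil => simp at hi
  | cons h p ih => cases i with
    | zero => simp
    | succ i => simpa using ih i (by simpa using hi)

theorem IsAlternatingPath.altSeq {u v : V} {p : G.Walk u v} (hp : IsAlternatingPath M p)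
    (hu : Unmatched M u) : AltSeq M p.getVert p.length where
  unmatched := by simpa using hu
  inj i hi j hj h := hp.1.getVert_injOn hi hj h
  adj i hi := p.adj_getVert_succ hi
  mem_iff i hi := by
    induction i with
    | zero => simpa using fun h => hu (M.mem_support.2 ⟨_, h⟩)
    | succ i ih =>
      have h := List.isChain_iff_getElem.1 hp.2 i (by simpa using hi)
      rw [edges_getElem, edges_getElem, SimpleGraph.Subgraph.mem_edgeSet,
        SimpleGraph.Subgraph.mem_edgeSet] at h
      have := ih (by omega)
      rw [Nat.odd_add_one]
      tauto

theorem exists_walk_getVert (x : ℕ → V) (n : ℕ) (h : ∀ i < n, G.Adj (x i) (x (i + 1))) :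
    ∃ p : G.Walk (x 0) (x n), p.length = n ∧ ∀ i ≤ n, p.getVert i = x i := by
  induction n generalizing x with
  | zero => exact ⟨.nil, rfl, fun i hi => by simp [Nat.le_zero.1 hi]⟩
  | succ n ih =>
    obtain ⟨p, hp, hpx⟩ := ih (fun i => x (i + 1)) (fun i hi => h (i + 1) (by omega))
    refine ⟨.cons (h 0 (by omega)) p, by simpa using hp, fun i hi => ?_⟩
    cases i with
    | zero => simp
    | succ i => simpa using hpx i (by omega)

theorem AltSeq.exists_isAlternatingPath {x : ℕ → V} {n : ℕ} (h : AltSeq M x n) :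
    ∃ p : G.Walk (x 0) (x n), IsAlternatingPath M p ∧ p.length = n := by
  obtain ⟨p, hp, hpx⟩ := exists_walk_getVert x n h.adj
  refine ⟨p, ⟨?_, ?_⟩, hp⟩
  · rw [← SimpleGraph.Walk.IsPath.getVert_injOn_iff]
    intro i hi j hj hij
    rw [Set.mem_ofPred_eq, hp] at hi hj
    rw [hpx i hi, hpx j hj] at hij
    exact h.inj i hi j hj hij
  · rw [List.isChain_iff_getElem]
    intro i hi
    rw [SimpleGraph.Walk.length_edges, hp] at hi
    rw [edges_getElem, edges_getElem, SimpleGraph.Subgraph.mem_edgeSet,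
      SimpleGraph.Subgraph.mem_edgeSet, hpx _ (by omega), hpx _ (by omega), hpx _ (by omega),
      h.mem_iff _ (by omega), h.mem_iff _ hi, Nat.odd_add_one, not_not]

/-! ### Truncated levels -/

/-- The length of a shortest alternating path from an unmatched vertex to `v` whose length has the
parity of `k`, truncated at `N`: the minimum of `N` and of `evenlevel M v` (for even `k`) or
`oddlevel M v` (for odd `k`). Truncation makes all levels natural numbers. -/
noncomputable def truncLevel (M : G.Subgraph) (N k : ℕ) (v : V) : ℕ :=
  sInf {n | n = N ∨ ∃ x, AltSeq M x n ∧ x n = v ∧ n % 2 = k % 2}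

/-- The sum of the two truncated levels. -/
noncomputable def truncTenacity (M : G.Subgraph) (N : ℕ) (v : V) : ℕ :=
  truncLevel M N 0 v + truncLevel M N 1 v

theorem truncLevel_le (N k : ℕ) (v : V) : truncLevel M N k v ≤ N :=
  Nat.sInf_le (Or.inl rfl)

theorem truncLevel_congr {N k l : ℕ} (h : k % 2 = l % 2) (v : V) :
    truncLevel M N k v = truncLevel M N l v := by
  simp only [truncLevel, h]

theorem truncLevel_eq_or (N k : ℕ) (v : V) :
    truncLevel M N k v = truncLevel M N 0 v ∧ k % 2 = 0 ∨
      truncLevel M N k v = truncLevel M N 1 v ∧ k % 2 = 1 := by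
  rcases Nat.mod_two_eq_zero_or_one k with h | h
  · exact Or.inl ⟨truncLevel_congr h v, h⟩
  · exact Or.inr ⟨truncLevel_congr h v, h⟩

theorem AltSeq.truncLevel_le {x : ℕ → V} {n : ℕ} (h : AltSeq M x n) (N : ℕ) {k : ℕ}
    (hk : n % 2 = k % 2) : truncLevel M N k (x n) ≤ n :=
  Nat.sInf_le (Or.inr ⟨x, h, rfl, hk⟩)

theorem exists_altSeq_of_truncLevel_lt {N k : ℕ} {v : V} (h : truncLevel M N k v < N) :
    ∃ x, AltSeq M x (truncLevel M N k v) ∧ x (truncLevel M N k v) = v ∧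
      truncLevel M N k v % 2 = k % 2 := by
  have hne : {n | n = N ∨ ∃ x, AltSeq M x n ∧ x n = v ∧ n % 2 = k % 2}.Nonempty := ⟨N, Or.inl rfl⟩
  rcases Nat.sInf_mem hne with h1 | h1
  · exact absurd h1 h.ne
  · exact h1

theorem truncLevel_of_unmatched {N : ℕ} {f : V} (hf : Unmatched M f) : truncLevel M N 0 f = 0 := by
  have h : AltSeq M (fun _ => f) 0 := ⟨hf, by omega, by omega, by omega⟩
  simpa using h.truncLevel_le N (k := 0) rfl

theorem truncLevel_zero_le_of_mate (hM : M.IsMatching) {N : ℕ} {u v : V} (huv : M.Adj u v) :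
    truncLevel M N 0 u ≤ truncLevel M N 1 v + 1 := by
  rcases (truncLevel_le (M := M) N 1 v).lt_or_eq with h | h
  · obtain ⟨x, hx, hxv, hpar⟩ := exists_altSeq_of_truncLevel_lt h
    set m := truncLevel M N 1 v with hm
    obtain ⟨z, hz, hzu⟩ := hx.exists_snoc (w := u) (fun i hi hiu => by
      rw [← hiu] at huv
      rcases Nat.mod_two_eq_zero_or_one i with h0 | h1
      · obtain ⟨h2, h3⟩ := hx.mate_of_even hM hi h0 huv
        have := hx.inj (i - 1) (by omega) m le_rfl (h3.trans hxv.symm)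
        omega
      · rcases hi.lt_or_eq with hlt | rfl
        · have := hx.inj (i + 1) (by omega) m le_rfl
            ((hx.mate_of_odd hM hlt h1 huv).trans hxv.symm)
          omega
        · rw [hxv] at huv
          exact huv.ne rfl)
      (by rw [hxv]; exact huv.adj_sub.symm)
      (by rw [hxv, Nat.odd_iff]; exact ⟨fun _ => by omega, fun _ => huv.symm⟩)
    rw [← hzu]
    exact hz.truncLevel_le N (by omega)
  · have := truncLevel_le (M := M) N 0 u
    omega

theorem truncLevel_one_lt_of_mate (hM : M.IsMatching) {N : ℕ} {u v : V} (huv : M.Adj u v)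
    (h : truncLevel M N 0 u < N) : truncLevel M N 1 v + 1 ≤ truncLevel M N 0 u := by
  obtain ⟨x, hx, hxu, hpar⟩ := exists_altSeq_of_truncLevel_lt h
  set m := truncLevel M N 0 u with hm
  rw [← hxu] at huv
  obtain ⟨h2, h3⟩ := hx.mate_of_even hM le_rfl (by omega) huv
  have := (hx.prefix (k := m - 1) (by omega)).truncLevel_le N (k := 1) (by omega)
  rw [h3] at this
  omega

/-- The breadth first search step along an edge outside the matching: a shortest even path to `v`
either extends to `u` or already meets `u`. -/
theorem truncLevel_one_le_or_zero_lt {N : ℕ} {u v : V} (hG : G.Adj u v) (hMn : ¬ M.Adj u v) :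
    truncLevel M N 1 u ≤ truncLevel M N 0 v + 1 ∨
      truncLevel M N 0 u < truncLevel M N 0 v := by
  rcases (truncLevel_le (M := M) N 0 v).lt_or_eq with h | h
  · obtain ⟨x, hx, hxv, hpar⟩ := exists_altSeq_of_truncLevel_lt h
    set n := truncLevel M N 0 v with hn
    by_cases hu : ∃ i ≤ n, x i = u
    · obtain ⟨i, hi, rfl⟩ := hu
      rcases Nat.mod_two_eq_zero_or_one i with h0 | h1
      · right
        have h2 := (hx.prefix hi).truncLevel_le N (k := 0) (by omega)
        have : i ≠ n := by
          rintro rfl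
          rw [hxv] at hG
          exact hG.ne rfl
        omega
      · left
        have h2 := (hx.prefix hi).truncLevel_le N (k := 1) (by omega)
        omega
    · left
      push Not at hu
      obtain ⟨z, hz, hzu⟩ := hx.exists_snoc hu (by rw [hxv]; exact hG.symm)
        (by rw [hxv, Nat.odd_iff]; exact ⟨fun h' => absurd h'.symm hMn, fun _ => by omega⟩)
      rw [← hzu]
      exact hz.truncLevel_le N (by omega)
  · left
    have := truncLevel_le (M := M) N 1 u
    omega

/-! ### Edges of bounded tenacity and their components -/

/-- The graph of all edges of tenacity at most `r`, where the tenacity of an edge `uv` is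
`oddlevel u + oddlevel v + 1` if it is matched and `evenlevel u + evenlevel v + 1` if not. -/
def tenacityGraph (M : G.Subgraph) (N r : ℕ) : SimpleGraph V where
  Adj u v := G.Adj u v ∧ ∃ k, (M.Adj u v ↔ Odd k) ∧
    truncLevel M N k u + truncLevel M N k v + 1 ≤ r
  symm := ⟨fun u v ⟨h, k, hk, hr⟩ =>
    ⟨h.symm, k, by rw [← hk]; exact ⟨fun h => h.symm, fun h => h.symm⟩, by omega⟩⟩
  loopless := ⟨fun _ h => h.1.ne rfl⟩

/-- Every component of the graph of edges of tenacity at most `r` has at most one vertex of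
tenacity greater than `r`. -/
def SingleBase (M : G.Subgraph) (N r : ℕ) : Prop :=
  ∀ u v, (tenacityGraph M N r).Reachable u v → r < truncTenacity M N u → r < truncTenacity M N v →
    u = v

open Classical in
/-- `0` if `u` and `v` are in the same component of the edges of tenacity at most `r`, else `1`. -/
noncomputable def crossing (M : G.Subgraph) (N r : ℕ) (u v : V) : ℕ :=
  if (tenacityGraph M N r).Reachable u v then 0 else 1

/-- `1` if the tenacity of `v` is greater than `r`, else `0`. -/
noncomputable def high (M : G.Subgraph) (N r : ℕ) (v : V) : ℕ :=
  if r < truncTenacity M N v then 1 else 0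

theorem crossing_comm (N r : ℕ) (u v : V) : crossing M N r u v = crossing M N r v u := by
  have : (tenacityGraph M N r).Reachable u v ↔ (tenacityGraph M N r).Reachable v u :=
    SimpleGraph.reachable_comm
  by_cases h : (tenacityGraph M N r).Reachable u v <;> simp [crossing, h, ← this]

theorem sum_high (N s : ℕ) (v : V) :
    ∑ r ∈ Finset.range s, high M N r v = min (truncTenacity M N v) s := by
  induction s with
  | zero => simp
  | succ s ih =>
    rw [Finset.sum_range_succ, ih, high]
    split_ifs <;> omega

theorem sum_crossing_le {N s e : ℕ} {u v : V}
    (h : ∀ r, e ≤ r → (tenacityGraph M N r).Reachable u v) :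
    ∑ r ∈ Finset.range s, crossing M N r u v ≤ min e s := by
  induction s with
  | zero => simp
  | succ s ih =>
    rw [Finset.sum_range_succ, crossing]
    split_ifs with h1
    · omega
    · have : ¬ e ≤ s := fun h2 => h1 (h s h2)
      omega

/-- A sequence of vertices without repetition splits into runs inside components of the edges of
tenacity at most `r`. Every run has at most one vertex of tenacity greater than `r`; this counts
the runs without such a vertex. -/
noncomputable def excess (M : G.Subgraph) (N r : ℕ) (x : ℕ → V) (n : ℕ) : ℤ :=
  ∑ k ∈ Finset.range n, (crossing M N r (x k) (x (k + 1)) : ℤ) + 1 -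
    ∑ k ∈ Finset.range (n + 1), (high M N r (x k) : ℤ)

theorem excess_zero (N r : ℕ) (x : ℕ → V) : excess M N r x 0 = 1 - high M N r (x 0) := by
  simp [excess]

theorem excess_succ (N r : ℕ) (x : ℕ → V) (n : ℕ) :
    excess M N r x (n + 1) =
      excess M N r x n + crossing M N r (x n) (x (n + 1)) - high M N r (x (n + 1)) := by
  simp only [excess, Finset.sum_range_succ]
  ring

theorem excess_nonneg {N r : ℕ} (hB : SingleBase M N r) {x : ℕ → V} {n : ℕ}
    (inj : ∀ i ≤ n, ∀ j ≤ n, x i = x j → i = j) :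
    0 ≤ excess M N r x n ∧ (excess M N r x n = 0 → ∃ h ≤ n, r < truncTenacity M N (x h) ∧
      ∀ i, h ≤ i → i ≤ n → (tenacityGraph M N r).Reachable (x i) (x n)) := by
  induction n with
  | zero =>
    rw [excess_zero, high]
    split_ifs with h
    · refine ⟨by simp, fun _ => ⟨0, le_rfl, h, fun i _ hi => ?_⟩⟩
      rw [Nat.le_zero.1 hi]
    · exact ⟨by simp, fun h' => by simp at h'⟩
  | succ n ih =>
    obtain ⟨ih1, ih2⟩ := ih fun i hi j hj => inj i (by omega) j (by omega)
    rw [excess_succ, high, crossing]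
    have single : r < truncTenacity M N (x (n + 1)) → ∃ h ≤ n + 1,
        r < truncTenacity M N (x h) ∧
        ∀ i, h ≤ i → i ≤ n + 1 → (tenacityGraph M N r).Reachable (x i) (x (n + 1)) :=
      fun h => ⟨n + 1, le_rfl, h, fun i h1 h2 => by rw [le_antisymm h2 h1]⟩
    split_ifs with h1 h2 h2
    · -- a second vertex of high tenacity in the current run would contradict `hB`
      have hne : excess M N r x n ≠ 0 := fun h0 => by
        obtain ⟨h, hn, hr, hreach⟩ := ih2 h0
        have := inj _ (by omega) _ le_rfl
          (hB _ _ ((hreach h le_rfl hn).trans h1) hr h2)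
        omega
      exact ⟨by push_cast; omega, fun _ => single h2⟩
    · refine ⟨by simpa using ih1, fun h0 => ?_⟩
      obtain ⟨h, hn, hr, hreach⟩ := ih2 (by simpa using h0)
      refine ⟨h, by omega, hr, fun i hi hi' => ?_⟩
      rcases Nat.lt_or_ge n i with h3 | h3
      · rw [show i = n + 1 by omega]
      · exact (hreach i hi h3).trans h1
    · exact ⟨by push_cast; omega, fun _ => single h2⟩
    · exact ⟨by push_cast; omega, fun h0 => by push_cast at h0; omega⟩

/-- Cutting a sequence at its `k`-th vertex: the excess of the part up to `k` and that of the
part from `k` on, traversed backwards. -/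
theorem excess_add_excess (N r : ℕ) (x : ℕ → V) {k n : ℕ} (hk : k ≤ n) :
    excess M N r x k + excess M N r (fun i => x (n - i)) (n - k) =
      excess M N r x n + 1 - high M N r (x k) := by
  induction k with
  | zero =>
    have h1 : ∑ i ∈ Finset.range n, (crossing M N r (x (n - i)) (x (n - (i + 1))) : ℤ) =
        ∑ i ∈ Finset.range n, (crossing M N r (x i) (x (i + 1)) : ℤ) := by
      rw [← Finset.sum_range_reflect]
      refine Finset.sum_congr rfl fun i hi => ?_
      rw [Finset.mem_range] at hi
      rw [crossing_comm, show n - (n - 1 - i + 1) = i by omega,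
        show n - (n - 1 - i) = i + 1 by omega]
    have h2 : ∑ i ∈ Finset.range (n + 1), (high M N r (x (n - i)) : ℤ) =
        ∑ i ∈ Finset.range (n + 1), (high M N r (x i) : ℤ) := by
      rw [← Finset.sum_range_reflect]
      refine Finset.sum_congr rfl fun i hi => ?_
      rw [Finset.mem_range] at hi
      rw [show n - (n + 1 - 1 - i) = i by omega]
    rw [excess_zero, Nat.sub_zero]
    simp only [excess, h1, h2]
    ring
  | succ k ih =>
    have ih := ih (by omega)
    rw [show n - k = n - (k + 1) + 1 by omega, excess_succ] at ih
    rw [excess_succ]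
    simp only [show n - (n - (k + 1)) = k + 1 by omega,
      show n - (n - (k + 1) + 1) = k by omega] at ih
    rw [crossing_comm] at ih
    linarith

/-! ### Weak duality -/

/-- The potential of `v` for arrival by an even path. It is the even level if the tenacity of `v`
is at most `s`. Otherwise at most one level of `v` is below `s / 2`, and the potential is chosen
such that it, or its complement to `s`, equals this level. -/
noncomputable def evenPotential (M : G.Subgraph) (N s : ℕ) (v : V) : ℕ :=
  if truncTenacity M N v ≤ s then truncLevel M N 0 v else
    max (s - truncLevel M N 1 v) (min (truncLevel M N 0 v) ((s + 1) / 2))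

theorem evenPotential_eq (N s : ℕ) (v : V) : evenPotential M N s v =
    if truncLevel M N 0 v + truncLevel M N 1 v ≤ s then truncLevel M N 0 v else
      max (s - truncLevel M N 1 v) (min (truncLevel M N 0 v) ((s + 1) / 2)) :=
  rfl

/-- The potential of `v` for arrival with the parity of `k`. The two potentials of `v` add up to
its tenacity truncated at `s`. -/
noncomputable def potential (M : G.Subgraph) (N s k : ℕ) (v : V) : ℤ :=
  if k % 2 = 0 then evenPotential M N s v
  else min (truncTenacity M N v) s - evenPotential M N s v

theorem potential_add_succ (N s k : ℕ) (v : V) :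
    potential M N s k v + potential M N s (k + 1) v = min (truncTenacity M N v) s := by
  rcases Nat.mod_two_eq_zero_or_one k with h | h
  · have h' : (k + 1) % 2 ≠ 0 := by omega
    simp only [potential, h, h', if_true, if_false]
    ring
  · have h' : (k + 1) % 2 = 0 := by omega
    simp only [potential, h, h', if_true, one_ne_zero, if_false]
    ring

theorem potential_congr {N s k l : ℕ} (h : k % 2 = l % 2) (v : V) :
    potential M N s k v = potential M N s l v := by
  simp only [potential, h]

theorem potential_of_le {N s k : ℕ} {v : V} (h : truncTenacity M N v ≤ s) :
    potential M N s k v = truncLevel M N k v := by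
  simp only [potential, evenPotential, h, if_true]
  simp only [truncTenacity] at h ⊢
  rcases truncLevel_eq_or (M := M) N k v with ⟨h1, h2⟩ | ⟨h1, h2⟩ <;> rw [h1] <;> simp [h2]
  omega

theorem potential_eq_truncLevel_zero {N s k : ℕ} {v : V} (hk : k % 2 = 0)
    (h : truncLevel M N 0 v ≤ (s + 1) / 2) : potential M N s k v = truncLevel M N 0 v := by
  have hv := evenPotential_eq (M := M) N s v
  simp only [potential, hk, if_true]
  split_ifs at hv <;> omega

theorem potential_of_unmatched {N s : ℕ} {f : V} (hf : Unmatched M f) :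
    potential M N s 0 f = 0 := by
  have := truncLevel_of_unmatched (N := N) hf
  rw [potential_eq_truncLevel_zero rfl (by omega), this, Nat.cast_zero]

/-- Feasibility of the potential as a dual solution. -/
theorem sum_crossing_le_potential (hM : M.IsMatching) {N s k : ℕ} (hs : s < N) {u v : V}
    (hG : G.Adj u v) (hk : M.Adj u v ↔ Odd k) :
    ((∑ r ∈ Finset.range s, crossing M N r u v : ℕ) : ℤ) ≤
      potential M N s k u + potential M N s k v + 1 := by
  have hc := sum_crossing_le (M := M) (N := N) (s := s)
    (e := truncLevel M N k u + truncLevel M N k v + 1) (u := u) (v := v)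
    fun r hr => SimpleGraph.Adj.reachable ⟨hG, k, hk, hr⟩
  have u0 := truncLevel_le (M := M) N 0 u
  have u1 := truncLevel_le (M := M) N 1 u
  have v0 := truncLevel_le (M := M) N 0 v
  have v1 := truncLevel_le (M := M) N 1 v
  rcases Nat.mod_two_eq_zero_or_one k with h | h
  · have hMn : ¬ M.Adj u v := by rw [hk, Nat.odd_iff]; omega
    have h1 := truncLevel_one_le_or_zero_lt (N := N) hG hMn
    have h2 := truncLevel_one_le_or_zero_lt (N := N) hG.symm fun h' => hMn h'.symm
    rw [truncLevel_congr (l := 0) h u, truncLevel_congr (l := 0) h v] at hc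
    simp only [potential, h, if_true]
    have hu := evenPotential_eq (M := M) N s u
    have hv := evenPotential_eq (M := M) N s v
    split_ifs at hu hv <;> omega
  · have huv : M.Adj u v := by rw [hk, Nat.odd_iff]; omega
    have h1 := truncLevel_zero_le_of_mate hM (N := N) huv
    have h2 := truncLevel_zero_le_of_mate hM (N := N) huv.symm
    have h3 := truncLevel_one_lt_of_mate hM (N := N) huv
    have h4 := truncLevel_one_lt_of_mate hM (N := N) huv.symm
    rw [truncLevel_congr (l := 1) h u, truncLevel_congr (l := 1) h v] at hc
    simp only [potential, h, one_ne_zero, if_false, truncTenacity]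
    have hu := evenPotential_eq (M := M) N s u
    have hv := evenPotential_eq (M := M) N s v
    split_ifs at hu hv <;> omega

/-- Weak duality for the part of an alternating path between its positions `k` and `n`. -/
theorem AltSeq.potential_mono (hM : M.IsMatching) {N s : ℕ} (hs : s < N) {x : ℕ → V} {k n : ℕ}
    (hx : AltSeq M x n) (hk : k ≤ n) :
    k - potential M N s k (x k) - ∑ r ∈ Finset.range s, excess M N r x k ≤
      n - potential M N s n (x n) - ∑ r ∈ Finset.range s, excess M N r x n := by
  induction n, hk using Nat.le_induction with
  | base => rfl
  | succ n hn ih =>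
    refine (ih (hx.prefix n.le_succ)).trans ?_
    have h1 := sum_crossing_le_potential hM hs (hx.adj n n.lt_succ_self)
      (hx.mem_iff n n.lt_succ_self)
    have h2 := potential_add_succ (M := M) N s n (x (n + 1))
    have h3 := sum_high (M := M) N s (x (n + 1))
    simp only [excess_succ, Finset.sum_add_distrib, Finset.sum_sub_distrib]
    push_cast at h1 ⊢
    have h4 : (∑ r ∈ Finset.range s, (high M N r (x (n + 1)) : ℤ)) =
        min (truncTenacity M N (x (n + 1)) : ℤ) s := by exact_mod_cast h3
    push_cast at h2
    linarith

/-- An alternating path whose length equals the potential of its end. -/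
structure IsTight (M : G.Subgraph) (N s : ℕ) (x : ℕ → V) (n : ℕ) : Prop where
  altSeq : AltSeq M x n
  length_eq : (n : ℤ) = potential M N s n (x n)

/-- The data under which weak duality is used: for every `r < s`,
the components of the edges of tenacity at most `r` are known to have a single base, and unmatched
vertices have tenacity at least `s`. -/
structure Admissible (M : G.Subgraph) (N s : ℕ) : Prop where
  isMatching : M.IsMatching
  lt : s < N
  le_tenacity : ∀ f, Unmatched M f → s ≤ truncTenacity M N f
  singleBase : ∀ r < s, SingleBase M N r

theorem Admissible.start {N s : ℕ} (ha : Admissible M N s) {x : ℕ → V} {n : ℕ}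
    (hx : AltSeq M x n) :
    (0 : ℕ) - potential M N s 0 (x 0) - ∑ r ∈ Finset.range s, excess M N r x 0 = 0 := by
  rw [potential_of_unmatched hx.unmatched, Finset.sum_eq_zero]
  · simp
  · intro r hr
    have := ha.le_tenacity _ hx.unmatched
    rw [Finset.mem_range] at hr
    rw [excess_zero, high, if_pos (by omega)]
    simp

/-- Complementary slackness: no run of a tight path lacks a vertex of high tenacity. -/
theorem IsTight.excess_eq_zero {N s : ℕ} (ha : Admissible M N s) {x : ℕ → V} {n : ℕ}
    (hx : IsTight M N s x n) {r : ℕ} (hr : r < s) : excess M N r x n = 0 := by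
  have h1 := hx.altSeq.potential_mono ha.isMatching ha.lt n.zero_le
  rw [ha.start hx.altSeq] at h1
  have h2 := hx.length_eq
  have h3 : ∀ r ∈ Finset.range s, 0 ≤ excess M N r x n := fun r hr =>
    (excess_nonneg (ha.singleBase r (Finset.mem_range.1 hr)) hx.altSeq.inj).1
  have h4 : ∑ r ∈ Finset.range s, excess M N r x n = 0 :=
    le_antisymm (by linarith) (Finset.sum_nonneg h3)
  exact (Finset.sum_eq_zero_iff_of_nonneg h3).1 h4 r (Finset.mem_range.2 hr)

/-- Each run of a tight path contains a vertex of high tenacity. -/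
theorem IsTight.exists_high {N s : ℕ} (ha : Admissible M N s) {x : ℕ → V} {n : ℕ}
    (hx : IsTight M N s x n) {r k : ℕ} (hr : r < s) (hk : k ≤ n) :
    ∃ h ≤ n, r < truncTenacity M N (x h) ∧ ∀ i, (h ≤ i ∧ i ≤ k ∨ k ≤ i ∧ i ≤ h) →
      (tenacityGraph M N r).Reachable (x i) (x k) := by
  have h0 := hx.excess_eq_zero ha hr
  have hadd := excess_add_excess (M := M) N r x hk
  have h1 := excess_nonneg (ha.singleBase r hr) (hx.altSeq.prefix hk).inj
  have h2 := excess_nonneg (ha.singleBase r hr) (x := fun i => x (n - i)) (n := n - k)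
    fun i hi j hj hij => by
      have := hx.altSeq.inj _ (by omega) _ (by omega) hij
      omega
  simp only [show n - (n - k) = k by omega] at h2
  by_cases hh : r < truncTenacity M N (x k)
  · refine ⟨k, hk, hh, fun i hi => ?_⟩
    rw [show i = k by omega]
  rw [high, if_neg hh] at hadd
  by_cases h3 : excess M N r x k = 0
  · obtain ⟨h, hn, hr, hreach⟩ := h1.2 h3
    refine ⟨h, by omega, hr, fun i hi => hreach i ?_ ?_⟩ <;> omega
  · obtain ⟨h, hn, hr, hreach⟩ := h2.2 (by have := h1.1; have := h2.1; push_cast at hadd; omega)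
    refine ⟨n - h, by omega, hr, fun i hi => ?_⟩
    have := hreach (n - i) (by omega) (by omega)
    rwa [show n - (n - i) = i by omega] at this

/-- A tight path reaches its vertices of high tenacity by tight paths. -/
theorem IsTight.prefix {N s : ℕ} (ha : Admissible M N s) {x : ℕ → V} {n : ℕ}
    (hx : IsTight M N s x n) {k : ℕ} (hk : k ≤ n) (hh : s ≤ truncTenacity M N (x k)) :
    IsTight M N s x k := by
  refine ⟨hx.altSeq.prefix hk, ?_⟩
  have h1 := (hx.altSeq.prefix hk).potential_mono ha.isMatching ha.lt (s := s) k.zero_le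
  have h2 := hx.altSeq.potential_mono ha.isMatching ha.lt (s := s) hk
  rw [ha.start hx.altSeq] at h1
  have h3 : ∑ r ∈ Finset.range s, excess M N r x n = 0 :=
    Finset.sum_eq_zero fun r hr => hx.excess_eq_zero ha (Finset.mem_range.1 hr)
  have h4 : ∑ r ∈ Finset.range s, excess M N r x k = 0 := by
    refine Finset.sum_eq_zero fun r hr => ?_
    rw [Finset.mem_range] at hr
    have hadd := excess_add_excess (M := M) N r x hk
    have h5 := excess_nonneg (ha.singleBase r hr) (hx.altSeq.prefix hk).inj
    have h6 := excess_nonneg (ha.singleBase r hr) (x := fun i => x (n - i)) (n := n - k)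
      fun i hi j hj hij => by
        have := hx.altSeq.inj _ (by omega) _ (by omega) hij
        omega
    rw [hx.excess_eq_zero ha hr, high, if_pos (by omega)] at hadd
    have := h5.1
    have := h6.1
    push_cast at hadd
    omega
  have h5 := hx.length_eq
  rw [h3] at h2
  rw [h4] at h1 h2
  linarith

/-! ### The exchange argument -/

theorem truncTenacity_mate (hM : M.IsMatching) {N : ℕ} {u v : V} (huv : M.Adj u v)
    (h : truncTenacity M N u < N) : truncTenacity M N v = truncTenacity M N u := by
  have h1 := truncLevel_zero_le_of_mate hM (N := N) huv
  have h2 := truncLevel_zero_le_of_mate hM (N := N) huv.symm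
  have h3 := truncLevel_one_lt_of_mate hM (N := N) huv
  have h4 := truncLevel_one_lt_of_mate hM (N := N) huv.symm
  have h5 := truncLevel_le (M := M) N 0 v
  simp only [truncTenacity] at h ⊢
  omega

theorem AltSeq.truncTenacity_le_add {N : ℕ} {x y : ℕ → V} {n m : ℕ} (hx : AltSeq M x n)
    (hy : AltSeq M y m) (h : x n = y m) (hpar : n % 2 ≠ m % 2) :
    truncTenacity M N (y m) ≤ n + m := by
  have h1 := hx.truncLevel_le N (k := n) rfl
  have h2 := hy.truncLevel_le N (k := m) rfl
  rw [h] at h1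
  rw [truncTenacity]
  rcases truncLevel_eq_or (M := M) N n (y m) with ⟨h3, h4⟩ | ⟨h3, h4⟩ <;>
    rcases truncLevel_eq_or (M := M) N m (y m) with ⟨h5, h6⟩ | ⟨h5, h6⟩ <;> omega

theorem IsTight.length_eq_of_mod_eq {N s : ℕ} {x y : ℕ → V} {n m : ℕ} (hx : IsTight M N s x n)
    (hy : IsTight M N s y m) (h : x n = y m) (hpar : n % 2 = m % 2) : n = m := by
  have h1 := hx.length_eq
  rw [h, potential_congr hpar, ← hy.length_eq] at h1
  exact_mod_cast h1

theorem IsTight.add_length_eq_of_mod_ne {N s : ℕ} {x y : ℕ → V} {n m : ℕ}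
    (hx : IsTight M N s x n) (hy : IsTight M N s y m) (h : x n = y m) (hpar : n % 2 ≠ m % 2) :
    n + m = min (truncTenacity M N (y m)) s := by
  have h1 := potential_add_succ (M := M) N s m (y m)
  rw [potential_congr (l := n) (by omega : (m + 1) % 2 = n % 2), ← hy.length_eq, ← h,
    ← hx.length_eq] at h1
  rw [← h]
  omega

/-- The `i`-th vertex is the last one of tenacity greater than `s`. -/
structure IsTop (M : G.Subgraph) (N s : ℕ) (x : ℕ → V) (n i : ℕ) : Prop where
  le : i ≤ n
  lt : s < truncTenacity M N (x i)
  last : ∀ j, i < j → j ≤ n → truncTenacity M N (x j) ≤ s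

theorem IsTop.mono {N s : ℕ} {x : ℕ → V} {n i k : ℕ} (h : IsTop M N s x n i) (hik : i ≤ k)
    (hk : k ≤ n) : IsTop M N s x k i :=
  ⟨hik, h.lt, fun j hj hjk => h.last j hj (hjk.trans hk)⟩

theorem exists_isTop {N s : ℕ} {x : ℕ → V} {n h : ℕ} (hh : h ≤ n)
    (hs : s < truncTenacity M N (x h)) : ∃ i, h ≤ i ∧ IsTop M N s x n i := by
  induction n, hh using Nat.le_induction with
  | base => exact ⟨h, le_rfl, le_rfl, hs, by omega⟩
  | succ n hn ih =>
    by_cases h1 : s < truncTenacity M N (x (n + 1))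
    · exact ⟨n + 1, by omega, le_rfl, h1, by omega⟩
    · obtain ⟨i, hi, hle, hlt, hlast⟩ := ih
      refine ⟨i, hi, by omega, hlt, fun j hj hjn => ?_⟩
      rcases hjn.lt_or_eq with h2 | rfl
      · exact hlast j hj (by omega)
      · omega

/-- Matched vertices have the same tenacity, so the last vertex of tenacity greater than `s` is
left by an unmatched edge. -/
theorem IsTop.even (hM : M.IsMatching) {N s : ℕ} (hs : s < N) {x : ℕ → V} {n i : ℕ}
    (h : IsTop M N s x n i) (hx : AltSeq M x n) (hn : n % 2 = 0 ∨ truncTenacity M N (x n) ≤ s) :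
    i % 2 = 0 := by
  by_contra hi
  have hlt := h.lt
  rcases h.le.lt_or_eq with h1 | rfl
  · have h2 := (hx.mem_iff i h1).2 (Nat.odd_iff.2 (by omega))
    have h3 := h.last (i + 1) (by omega) h1
    have := truncTenacity_mate hM h2.symm (by omega : _ < N)
    omega
  · omega

/-- Two tight paths with different last vertices `x i`, `y j` of tenacity greater than `s`: either
the second path avoids the first one from position `j` on, or the paths meet again, at the same
position, in a vertex of tenacity `s`.

Otherwise, follow the second path from `y j` to its first vertex `y k` on the first path. The runs
of both paths through the component of `y k` contain the same vertex `u` of tenacity `s`. Where the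
paths reach `u` with different parities, the first path up to `u` followed by the second one from
`u` back to `y j` is an alternating path showing that the tenacity of `y j` is at most `s`. -/
theorem IsTight.disjoint_or_meet {N s : ℕ} (ha : Admissible M N s) (hs : 0 < s) {x y : ℕ → V}
    {n m i j : ℕ} (hx : IsTight M N s x n) (hy : IsTight M N s y m) (hi : IsTop M N s x n i)
    (hj : IsTop M N s y m j) (hj0 : j % 2 = 0) (hij : i ≤ j) (hne : x i ≠ y j) :
    (∀ l ≤ n, ∀ k ≤ m, j ≤ k → x l ≠ y k) ∨
      ∃ k, i < k ∧ j < k ∧ k ≤ n ∧ k ≤ m ∧ x k = y k ∧ truncTenacity M N (y k) = s := by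
  have hjt := hj.lt
  have hjm := hj.le
  have hyj : IsTight M N s y j := hy.prefix ha hj.le hj.lt.le
  -- no alternating path of odd length at most `s - j` leads to `y j`
  have no_path : ∀ (z : ℕ → V) (a : ℕ), AltSeq M z a → z a = y j → a % 2 = 1 → s < a + j :=
    fun z a hz hzj hpar =>
      hj.lt.trans_le (hz.truncTenacity_le_add hyj.altSeq hzj (by omega))
  have hjx : ∀ l ≤ n, x l ≠ y j := by
    intro l hl hlj
    have hxl : IsTight M N s x l := hx.prefix ha hl (by rw [hlj]; omega)
    by_cases hpar : l % 2 = j % 2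
    · have h1 := hxl.length_eq_of_mod_eq hyj hlj hpar
      rcases hij.lt_or_eq with h2 | h2
      · have := hi.last l (by omega) hl
        rw [hlj] at this
        omega
      · rw [h2, ← h1] at hne
        exact hne (by rw [hlj, h1])
    · have h1 := hxl.add_length_eq_of_mod_ne hyj hlj hpar
      have := no_path x l hxl.altSeq hlj (by omega)
      omega
  by_cases hex : ∃ k, j ≤ k ∧ k ≤ m ∧ ∃ l ≤ n, x l = y k
  swap
  · exact Or.inl fun l hl k hk hjk h => hex ⟨k, hjk, hk, l, hl, h⟩
  right
  classical
  obtain ⟨k, hk⟩ : ∃ k, k = Nat.find hex := ⟨_, rfl⟩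
  obtain ⟨hjk, hkm, l, hl, hlk⟩ := Nat.find_spec hex
  have hmin : ∀ a, j ≤ a → a ≤ m → ∀ b ≤ n, x b = y a → k ≤ a := fun a h1 h2 b h3 h4 =>
    hk ▸ Nat.find_min' hex ⟨h1, h2, b, h3, h4⟩
  rw [← hk] at hjk hkm hlk
  have hB : SingleBase M N (s - 1) := ha.singleBase _ (by omega)
  obtain ⟨k', hk'm, hk'h, hk'r⟩ := hy.exists_high ha (r := s - 1) (by omega) hkm
  obtain ⟨l', hl'n, hl'h, hl'r⟩ := hx.exists_high ha (r := s - 1) (by omega) hl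
  have hu : x l' = y k' := by
    refine hB _ _ ?_ hl'h hk'h
    refine (hl'r l' (by omega)).trans ?_
    rw [hlk]
    exact (hk'r k' (by omega)).symm
  have hjk' : j < k' := by
    by_contra hlt
    have h1 := hB _ _ ((hk'r j (by omega)).trans (hk'r k' (by omega)).symm) (by omega) hk'h
    have h2 := hy.altSeq.inj j hjm k' hk'm h1
    exact hjx l' hl'n (by rw [hu, h2])
  have hten : truncTenacity M N (y k') = s := by
    have := hj.last k' hjk' hk'm
    omega
  have hxl' : IsTight M N s x l' := hx.prefix ha hl'n (by rw [hu]; omega)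
  have hyk' : IsTight M N s y k' := hy.prefix ha hk'm (by omega)
  by_cases hpar : l' % 2 = k' % 2
  · have h1 := hxl'.length_eq_of_mod_eq hyk' hu hpar
    subst h1
    exact ⟨l', by omega, hjk', hl'n, hk'm, hu, hten⟩
  exfalso
  have hsum := hxl'.add_length_eq_of_mod_ne hyk' hu hpar
  rw [hten, min_self] at hsum
  have hstep := hy.altSeq.mem_iff (k' - 1) (by omega)
  have hadj := hy.altSeq.adj (k' - 1) (by omega)
  rw [show k' - 1 + 1 = k' by omega, ← hu] at hstep hadj
  -- the mate of `u` is in another component, as it has the tenacity of `u`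
  have mate : ∀ w, M.Adj (y k') w → ¬ (tenacityGraph M N (s - 1)).Reachable w (y k') := by
    intro w hw hr
    have h1 := truncTenacity_mate ha.isMatching hw (by have := ha.lt; omega : _ < N)
    exact hw.ne (hB _ _ hr (by omega) (by omega)).symm
  have disj : ∀ b ≤ l', ∀ a ≤ k' - 1, j ≤ a → x b ≠ y a := by
    intro b hb a hak hja hab
    have hka := hmin a hja (by omega) b (by omega) hab
    have hreach : ∀ c, k ≤ c → c ≤ k' →
        (tenacityGraph M N (s - 1)).Reachable (y c) (y k') := fun c h1 h2 =>
      (hk'r c (by omega)).trans (hk'r k' (by omega)).symm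
    by_cases hk0 : k' % 2 = 0
    · have h1 := hstep.2 (Nat.odd_iff.2 (by omega))
      rw [hu] at h1
      exact mate _ h1.symm (hreach _ (by omega) (by omega))
    · -- the first path enters `u` through its mate, hence was not in the component before
      have hbl : b ≠ l' := by
        rintro rfl
        have := hy.altSeq.inj a (by omega) k' hk'm (hab.symm.trans hu)
        omega
      obtain ⟨c, hcn, hch, hcr⟩ := hx.exists_high ha (r := s - 1) (k := b) (by omega) (by omega)
      have hb' : (tenacityGraph M N (s - 1)).Reachable (x b) (x l') := by
        rw [hab, hu]
        exact hreach a hka (by omega)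
      have hc := hx.altSeq.inj c hcn l' hl'n
        (hB _ _ ((hcr c (by omega)).trans hb') hch hl'h)
      subst hc
      have h1 := (hx.altSeq.mem_iff (c - 1) (by omega)).2 (Nat.odd_iff.2 (by omega))
      rw [show c - 1 + 1 = c by omega, hu] at h1
      refine mate _ h1.symm ?_
      rw [← hu]
      exact (hcr (c - 1) (by omega)).trans hb'
  obtain ⟨z, hz, hzj⟩ := hxl'.altSeq.exists_join (hy.altSeq.prefix (k := k' - 1) (by omega))
    (j := j) (by omega) (by omega) hadj.symm
    (by
      rw [SimpleGraph.Subgraph.adj_comm, hstep, Nat.odd_iff, Nat.odd_iff]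
      omega) disj
  have := no_path z _ hz hzj (by omega)
  omega

/-- An even or odd path of minimum length to a vertex of tenacity at most `s` is tight. -/
theorem exists_isTight_of_le {N s : ℕ} (hs : s < N) {v : V} (hv : truncTenacity M N v ≤ s)
    (k : ℕ) : ∃ x n, IsTight M N s x n ∧ x n = v ∧ n % 2 = k % 2 := by
  have h : truncLevel M N k v < N := by
    rw [truncTenacity] at hv
    rcases truncLevel_eq_or (M := M) N k v with ⟨h3, h4⟩ | ⟨h3, h4⟩ <;> omega
  obtain ⟨x, hx, hxv, hpar⟩ := exists_altSeq_of_truncLevel_lt h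
  refine ⟨x, _, ⟨hx, ?_⟩, hxv, hpar⟩
  rw [hxv, potential_of_le hv, truncLevel_congr hpar]

theorem IsTight.length_eq_truncLevel {N s : ℕ} {x : ℕ → V} {n : ℕ} (hx : IsTight M N s x n)
    (hv : truncTenacity M N (x n) ≤ s) : n = truncLevel M N n (x n) := by
  have := hx.length_eq
  rw [potential_of_le hv] at this
  exact_mod_cast this

/-- All tight paths to a vertex of tenacity at most `s` have the same last vertex of
tenacity greater than `s`. By the exchange argument, two of them that differ in this respect meet
again in a vertex that is also a counterexample, and whose smaller level is less. -/
theorem IsTight.top_eq {N s : ℕ} (ha : Admissible M N s) (hs : 0 < s)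
    (hf : ∀ f, Unmatched M f → s < truncTenacity M N f) {x y : ℕ → V}
    {n m i j : ℕ} (hx : IsTight M N s x n) (hy : IsTight M N s y m) (hxy : x n = y m)
    (hv : truncTenacity M N (y m) ≤ s) (hi : IsTop M N s x n i) (hj : IsTop M N s y m j) :
    x i = y j := by
  obtain ⟨d, hd⟩ : ∃ d, min (truncLevel M N 0 (y m)) (truncLevel M N 1 (y m)) = d := ⟨_, rfl⟩
  induction d using Nat.strong_induction_on generalizing x y n m i j with
  | _ d ih =>
    have opposite : ∀ {x y : ℕ → V} {n m i j : ℕ}, IsTight M N s x n → IsTight M N s y m →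
        x n = y m → truncTenacity M N (y m) ≤ s → IsTop M N s x n i → IsTop M N s y m j →
        min (truncLevel M N 0 (y m)) (truncLevel M N 1 (y m)) = d → n % 2 ≠ m % 2 → i ≤ j →
        x i = y j := by
      intro x y n m i j hx hy hxy hv hi hj hd hpar hij
      by_contra hne
      have hj0 := hj.even ha.isMatching ha.lt hy.altSeq (Or.inr hv)
      rcases hx.disjoint_or_meet ha hs hy hi hj hj0 hij hne with h | ⟨k, hik, hjk, hkn, hkm, h, ht⟩
      · exact h n le_rfl m le_rfl hj.le hxy
      have hkx := hx.prefix ha hkn (by rw [h]; omega)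
      have hky := hy.prefix ha hkm (by omega)
      refine hne (ih _ ?_ hkx hky h ht.le (hi.mono hik.le hkn) (hj.mono hjk.le hkm) rfl)
      have hk : k < n ∧ k < m := by
        constructor
        · refine hkn.lt_of_ne ?_
          rintro rfl
          have := hy.altSeq.inj k hkm m le_rfl (h.symm.trans hxy)
          omega
        · refine hkm.lt_of_ne ?_
          rintro rfl
          have := hx.altSeq.inj k hkn n le_rfl (h.trans hxy.symm)
          omega
      have h1 := hx.length_eq_truncLevel (by rwa [hxy])
      have h2 := hy.length_eq_truncLevel hv
      have h3 := hky.length_eq_truncLevel ht.le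
      rw [hxy] at h1
      rcases truncLevel_eq_or (M := M) N n (y m) with ⟨h4, _⟩ | ⟨h4, _⟩ <;>
        rcases truncLevel_eq_or (M := M) N m (y m) with ⟨h5, _⟩ | ⟨h5, _⟩ <;>
        rcases truncLevel_eq_or (M := M) N k (y k) with ⟨h6, _⟩ | ⟨h6, _⟩ <;> omega
    have opposite' : ∀ {x y : ℕ → V} {n m i j : ℕ}, IsTight M N s x n → IsTight M N s y m →
        x n = y m → truncTenacity M N (y m) ≤ s → IsTop M N s x n i → IsTop M N s y m j →
        min (truncLevel M N 0 (y m)) (truncLevel M N 1 (y m)) = d → n % 2 ≠ m % 2 →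
        x i = y j := by
      intro x y n m i j hx hy hxy hv hi hj hd hpar
      rcases le_total i j with hij | hij
      · exact opposite hx hy hxy hv hi hj hd hpar hij
      · rw [← hxy] at hv hd
        exact (opposite hy hx hxy.symm hv hj hi hd hpar.symm hij).symm
    by_cases hpar : n % 2 = m % 2
    · -- compare both with a path of the other parity
      obtain ⟨z, l, hz, hzv, hzl⟩ := exists_isTight_of_le ha.lt hv (m + 1)
      obtain ⟨h, -, hh⟩ := exists_isTop (M := M) (N := N) (s := s) (x := z) (Nat.zero_le l)
        (hf _ hz.altSeq.unmatched)
      exact (opposite' hx hz (hxy.trans hzv.symm) (by rwa [hzv]) hi hh (by rwa [hzv])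
        (by omega)).trans (opposite' hz hy hzv hv hh hj hd (by omega))
    · exact opposite' hx hy hxy hv hi hj hd hpar

/-! ### Components have a single base -/

/-- Tight paths to the ends of an edge of tenacity at most `s` have the same last vertex of tenacity
greater than `s`. -/
theorem IsTight.top_eq_of_adj {N s : ℕ} (ha : Admissible M N s) (hs : 0 < s)
    (hf : ∀ f, Unmatched M f → s < truncTenacity M N f) {x y : ℕ → V} {n m i j : ℕ}
    (hx : IsTight M N s x n) (hy : IsTight M N s y m) (hi : IsTop M N s x n i)
    (hj : IsTop M N s y m j) (hj0 : j % 2 = 0) (hij : i ≤ j) (hpar : n % 2 = m % 2)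
    (hadj : G.Adj (x n) (y m)) (hmem : M.Adj (x n) (y m) ↔ Odd n) (hlen : n + m + 1 ≤ s) :
    x i = y j := by
  by_contra hne
  rcases hx.disjoint_or_meet ha hs hy hi hj hj0 hij hne with h | ⟨k, hik, hjk, hkn, hkm, h, ht⟩
  · obtain ⟨z, hz, hzj⟩ := hx.altSeq.exists_join hy.altSeq hj.le hpar hadj hmem h
    have hjm := hj.le
    have h1 := hz.truncTenacity_le_add (N := N) (hy.altSeq.prefix hj.le) hzj (by omega)
    have := hj.lt
    omega
  · exact hne ((hx.prefix ha hkn (by rw [h]; omega)).top_eq ha hs hf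
      (hy.prefix ha hkm (by omega)) h ht.le (hi.mono hik.le hkn) (hj.mono hjk.le hkm))

/-- `b` is the last vertex of tenacity greater than `s` on some tight path to `v`. -/
def HasTop (M : G.Subgraph) (N s : ℕ) (v b : V) : Prop :=
  ∃ x n i, IsTight M N s x n ∧ x n = v ∧ IsTop M N s x n i ∧ x i = b

theorem HasTop.eq_self {N s : ℕ} {v b : V} (h : HasTop M N s v b)
    (hv : s < truncTenacity M N v) : b = v := by
  obtain ⟨x, n, i, -, rfl, hi, rfl⟩ := h
  rcases hi.le.lt_or_eq with h | h
  · have := hi.last n h le_rfl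
    omega
  · rw [h]

theorem HasTop.unique {N s : ℕ} (ha : Admissible M N s) (hs : 0 < s)
    (hf : ∀ f, Unmatched M f → s < truncTenacity M N f) {v b c : V} (hb : HasTop M N s v b)
    (hc : HasTop M N s v c) : b = c := by
  rcases lt_or_ge s (truncTenacity M N v) with hv | hv
  · rw [hb.eq_self hv, hc.eq_self hv]
  · obtain ⟨x, n, i, hx, rfl, hi, rfl⟩ := hb
    obtain ⟨y, m, j, hy, hxy, hj, rfl⟩ := hc
    exact hx.top_eq ha hs hf hy hxy.symm (by rwa [hxy]) hi hj

/-- Paths of minimum length to an end of an edge of tenacity at most `s`, of the parity that allows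
continuing along this edge, are tight. -/
theorem exists_isTight_of_adj {N s k : ℕ} (hM : M.IsMatching) (hs : s < N) {u v : V}
    (hG : G.Adj u v) (hk : M.Adj u v ↔ Odd k)
    (h : truncLevel M N k u + truncLevel M N k v + 1 ≤ s) :
    ∃ x, IsTight M N s x (truncLevel M N k u) ∧ x (truncLevel M N k u) = u ∧
      truncLevel M N k u % 2 = k % 2 ∧ (k % 2 = 0 ∨ truncTenacity M N u ≤ s) := by
  obtain ⟨x, hx, hxu, hpar⟩ :=
    exists_altSeq_of_truncLevel_lt (by omega : truncLevel M N k u < N)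
  have key : truncTenacity M N u ≤ s ∨ k % 2 = 0 ∧ truncLevel M N 0 u ≤ (s + 1) / 2 := by
    rw [truncTenacity]
    rcases Nat.mod_two_eq_zero_or_one k with h0 | h1
    · rw [truncLevel_congr (l := 0) h0 u, truncLevel_congr (l := 0) h0 v] at h
      rcases truncLevel_one_le_or_zero_lt (N := N) hG
        (by rw [hk, Nat.odd_iff]; omega) with h2 | h2 <;> omega
    · rw [truncLevel_congr (l := 1) h1 u, truncLevel_congr (l := 1) h1 v] at h
      have := truncLevel_zero_le_of_mate hM (N := N) (hk.2 (Nat.odd_iff.2 h1))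
      omega
  refine ⟨x, ⟨hx, ?_⟩, hxu, hpar, by omega⟩
  rw [hxu]
  rcases key with h1 | ⟨h1, h2⟩
  · rw [potential_of_le h1, truncLevel_congr hpar]
  · rw [potential_eq_truncLevel_zero (hpar.trans h1) h2, truncLevel_congr (l := 0) h1]

theorem exists_hasTop_of_adj {N s : ℕ} (ha : Admissible M N s)
    (hf : ∀ f, Unmatched M f → s < truncTenacity M N f) {u v : V}
    (h : (tenacityGraph M N s).Adj u v) : ∃ b, HasTop M N s u b ∧ HasTop M N s v b := by
  obtain ⟨hG, k, hk, hle⟩ := h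
  obtain ⟨x, hx, hxu, hpx, hx0⟩ := exists_isTight_of_adj ha.isMatching ha.lt hG hk hle
  obtain ⟨y, hy, hyv, hpy, hy0⟩ := exists_isTight_of_adj ha.isMatching ha.lt hG.symm
    (by rw [SimpleGraph.Subgraph.adj_comm, hk]) (by omega : truncLevel M N k v +
      truncLevel M N k u + 1 ≤ s)
  obtain ⟨i, -, hi⟩ := exists_isTop (Nat.zero_le _) (hf _ hx.altSeq.unmatched)
  obtain ⟨j, -, hj⟩ := exists_isTop (Nat.zero_le _) (hf _ hy.altSeq.unmatched)
  refine ⟨x i, ⟨x, _, i, hx, hxu, hi, rfl⟩, y, _, j, hy, hyv, hj, ?_⟩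
  have hi0 := hi.even ha.isMatching ha.lt hx.altSeq (by rw [hxu]; omega)
  have hj0 := hj.even ha.isMatching ha.lt hy.altSeq (by rw [hyv]; omega)
  have hadj : G.Adj (x (truncLevel M N k u)) (y (truncLevel M N k v)) := by rwa [hxu, hyv]
  have hmem : M.Adj (x (truncLevel M N k u)) (y (truncLevel M N k v)) ↔ Odd k := by
    rwa [hxu, hyv]
  rcases le_total i j with hij | hij
  · refine (hx.top_eq_of_adj ha (by omega) hf hy hi hj hj0 hij (by omega) hadj ?_ (by omega)).symm
    rw [hmem, Nat.odd_iff, Nat.odd_iff, hpx]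
  · refine hy.top_eq_of_adj ha (by omega) hf hx hj hi hi0 hij (by omega) hadj.symm ?_ (by omega)
    rw [SimpleGraph.Subgraph.adj_comm, hmem, Nat.odd_iff, Nat.odd_iff, hpy]

theorem Admissible.singleBase_self {N s : ℕ} (ha : Admissible M N s)
    (hf : ∀ f, Unmatched M f → s < truncTenacity M N f) : SingleBase M N s := by
  intro u v ⟨p⟩ hu hv
  cases p with
  | nil => rfl
  | cons h p =>
    rename_i w
    have hs : 0 < s := by
      obtain ⟨-, k, -, hk⟩ := h
      omega
    obtain ⟨b, hub, hwb⟩ := exists_hasTop_of_adj ha hf h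
    have hvb : HasTop M N s v b := by
      clear hv h hub
      induction p with
      | nil => exact hwb
      | cons h p ih =>
        obtain ⟨c, hc, hc'⟩ := exists_hasTop_of_adj ha hf h
        rw [hwb.unique ha hs hf hc] at ih ⊢
        exact ih hc'
    rw [← hub.eq_self hu, hvb.eq_self hv]

/-- Unmatched vertices of tenacity greater than `t` are all that is needed of the absence of short
augmenting paths. -/
theorem singleBase_of_lt (hM : M.IsMatching) {N t : ℕ} (ht : t < N)
    (hf : ∀ f, Unmatched M f → t < truncTenacity M N f) (r : ℕ) (hr : r ≤ t) :
    SingleBase M N r := by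
  induction r using Nat.strong_induction_on with
  | _ r ih =>
    exact Admissible.singleBase_self
      ⟨hM, by omega, fun f h => by have := hf f h; omega, fun q hq => ih q hq (by omega)⟩
      fun f h => by have := hf f h; omega

/-! ### Levels and truncated levels -/

theorem coe_min (a b : ℕ) : ((min a b : ℕ) : ℕ∞) = min (a : ℕ∞) (b : ℕ∞) :=
  Nat.mono_cast.map_min

theorem truncLevel_eq_min {N k : ℕ} {v : V} {l : ℕ∞} {p : ℕ → Prop}
    (hp : ∀ n, p n ↔ n % 2 = k % 2)
    (hl : l = sInf {a : ℕ∞ | ∃ (f : V) (q : G.Walk f v),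
      Unmatched M f ∧ IsAlternatingPath M q ∧ p q.length ∧ a = q.length}) :
    (truncLevel M N k v : ℕ∞) = min l N := by
  apply le_antisymm
  · refine le_min ?_ (by exact_mod_cast truncLevel_le N k v)
    rw [hl]
    refine le_sInf ?_
    rintro _ ⟨f, q, hf, hq, hpar, rfl⟩
    have := (hq.altSeq hf).truncLevel_le N ((hp _).1 hpar)
    rw [SimpleGraph.Walk.getVert_length] at this
    exact_mod_cast this
  · rcases (truncLevel_le (M := M) N k v).lt_or_eq with h | h
    · obtain ⟨x, hx, hxv, hpar⟩ := exists_altSeq_of_truncLevel_lt h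
      obtain ⟨q, hq, hql⟩ := hx.exists_isAlternatingPath
      refine (min_le_left _ _).trans ?_
      rw [hl]
      refine sInf_le ⟨x 0, q.copy rfl hxv, hx.unmatched, ?_, ?_, ?_⟩
      · generalize truncLevel M N k v = n at *
        subst hxv
        exact hq
      · rw [SimpleGraph.Walk.length_copy, hql, hp]
        exact hpar
      · rw [SimpleGraph.Walk.length_copy, hql]
    · rw [h]
      exact min_le_right _ _

theorem truncLevel_zero_eq_min (N : ℕ) (v : V) :
    (truncLevel M N 0 v : ℕ∞) = min (evenlevel M v) N :=
  truncLevel_eq_min (p := Even) (fun _ => Nat.even_iff) rfl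

theorem truncLevel_one_eq_min (N : ℕ) (v : V) :
    (truncLevel M N 1 v : ℕ∞) = min (oddlevel M v) N :=
  truncLevel_eq_min (p := Odd) (fun _ => Nat.odd_iff) rfl

theorem lt_truncTenacity_iff {N t : ℕ} (ht : t < N) (v : V) :
    t < truncTenacity M N v ↔ (t : ℕ∞) < tenacity M v := by
  rw [← not_iff_not, not_lt, not_lt, truncTenacity, tenacity]
  have h0 := truncLevel_zero_eq_min (M := M) N v
  have h1 := truncLevel_one_eq_min (M := M) N v
  generalize truncLevel M N 0 v = a at *
  generalize truncLevel M N 1 v = b at *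
  cases he : evenlevel M v with
  | top =>
    rw [he, min_eq_right le_top, Nat.cast_inj] at h0
    simp
    omega
  | coe e =>
    cases ho : oddlevel M v with
    | top =>
      rw [ho, min_eq_right le_top, Nat.cast_inj] at h1
      simp
      omega
    | coe o =>
      rw [he, ← coe_min, Nat.cast_inj] at h0
      rw [ho, ← coe_min, Nat.cast_inj] at h1
      norm_cast
      omega

theorem minAugLength_le_tenacity {f : V} (hf : Unmatched M f) :
    minAugLength M ≤ tenacity M f := by
  refine le_trans ?_ le_add_self
  refine le_sInf ?_
  rintro _ ⟨g, p, hg, hp, hodd, rfl⟩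
  refine sInf_le ⟨g, f, p, ⟨hp, hg, hf, ?_⟩, rfl⟩
  rintro rfl
  rw [SimpleGraph.Walk.length_eq_zero_iff.2 (SimpleGraph.Walk.isPath_iff_nil.1 hp.1)] at hodd
  simp at hodd

/-! ### The base of a vertex -/

theorem IsBaseOn.unique {f v b c : V} {p : G.Walk f v} (hb : IsBaseOn M p b)
    (hc : IsBaseOn M p c) : b = c := by
  obtain ⟨i, hi, rfl, hti, hlast⟩ := hb
  obtain ⟨j, hj, rfl, htj, hlast'⟩ := hc
  rw [le_antisymm (hlast' i hi hti) (hlast j hj htj)]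

end AltPath

theorem mainTheorem3 {V : Type*} [Finite V] (G : SimpleGraph V) (M : G.Subgraph)
    (hM : M.IsMatching) (v : V) (hv : AltPath.tenacity M v < AltPath.minAugLength M) :
    (∀ (f : V) (p : G.Walk f v),
      AltPath.IsEvenlevelPath M p ∨ AltPath.IsOddlevelPath M p →
        ∃! b : V, AltPath.IsBaseOn M p b) ∧
    ∃ b : V, AltPath.baseSet M v = {b} := by
  open AltPath in
  obtain ⟨t, ht⟩ := ENat.ne_top_iff_exists.1 (ne_top_of_lt hv)
  rw [← ht] at hv
  have hf : ∀ f, Unmatched M f → t < truncTenacity M (t + 2) f := fun f hf =>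
    (lt_truncTenacity_iff (by omega) f).2 (hv.trans_le (minAugLength_le_tenacity hf))
  have hB := singleBase_of_lt hM (by omega) hf
  have ha : Admissible M (t + 2) (t + 1) := ⟨hM, by omega, hf, fun r hr => hB r (by omega)⟩
  have htv : truncTenacity M (t + 2) v ≤ t := by
    rw [← not_lt, lt_truncTenacity_iff (by omega), ht]
    exact lt_irrefl _
  have hlev : truncLevel M (t + 2) 0 v < t + 2 ∧ truncLevel M (t + 2) 1 v < t + 2 := by
    rw [truncTenacity] at htv
    omega
  -- the base on each level path is the vertex of tenacity greater than `t` in the component of `v`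
  have key : ∀ (f : V) (p : G.Walk f v), IsEvenlevelPath M p ∨ IsOddlevelPath M p →
      ∃ b, IsBaseOn M p b ∧ (tenacityGraph M (t + 2) t).Reachable b v ∧
        t < truncTenacity M (t + 2) b := by
    intro f p hp
    have hp' : ∃ k, k % 2 = p.length % 2 ∧ Unmatched M f ∧ IsAlternatingPath M p ∧
        p.length = truncLevel M (t + 2) k v := by
      have h0 := truncLevel_zero_eq_min (M := M) (t + 2) v
      have h1 := truncLevel_one_eq_min (M := M) (t + 2) v
      rcases hp with ⟨hu, hp, hpar, hl⟩ | ⟨hu, hp, hpar, hl⟩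
      · refine ⟨0, (Nat.even_iff.1 hpar).symm, hu, hp, ?_⟩
        rw [← hl, ← coe_min, Nat.cast_inj] at h0
        omega
      · refine ⟨1, (Nat.odd_iff.1 hpar).symm, hu, hp, ?_⟩
        rw [← hl, ← coe_min, Nat.cast_inj] at h1
        omega
    obtain ⟨k, hk, hu, hp, hl⟩ := hp'
    have hx : IsTight M (t + 2) (t + 1) p.getVert p.length := by
      refine ⟨hp.altSeq hu, ?_⟩
      rw [SimpleGraph.Walk.getVert_length, potential_of_le (by omega),
        truncLevel_congr hk.symm, ← hl]
    obtain ⟨h, hhn, hht, hhr⟩ := hx.exists_high ha (r := t) (by omega) le_rfl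
    obtain ⟨i, hhi, hi⟩ := exists_isTop hhn hht
    rw [SimpleGraph.Walk.getVert_length] at hhr
    refine ⟨p.getVert i, ⟨i, hi.le, rfl, ?_, fun j hj hjt => ?_⟩,
      hhr i (Or.inl ⟨hhi, hi.le⟩), hi.lt⟩
    · rw [← ht, ← lt_truncTenacity_iff (N := t + 2) (by omega)]
      exact hi.lt
    · rw [← ht, ← lt_truncTenacity_iff (N := t + 2) (by omega)] at hjt
      by_contra hij
      have := hi.last j (by omega) hj
      omega
  refine ⟨fun f p hp => ?_, ?_⟩
  · obtain ⟨b, hb, -⟩ := key f p hp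
    exact ⟨b, hb, fun c hc => hc.unique hb⟩
  · obtain ⟨x, hx, hxv, hpar⟩ := exists_altSeq_of_truncLevel_lt hlev.1
    obtain ⟨q, hq, hql⟩ := hx.exists_isAlternatingPath
    have hqe : IsEvenlevelPath M (q.copy rfl hxv) := by
      have h0 := truncLevel_zero_eq_min (M := M) (t + 2) v
      have h1 := hlev.1
      generalize truncLevel M (t + 2) 0 v = n at *
      subst hxv
      refine ⟨hx.unmatched, hq, by rw [SimpleGraph.Walk.length_copy, hql, Nat.even_iff, hpar], ?_⟩
      rw [SimpleGraph.Walk.length_copy, hql, h0, min_eq_left_iff]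
      by_contra hlt
      rw [min_eq_right (not_le.1 hlt).le, Nat.cast_inj] at h0
      omega
    obtain ⟨b, hb, hbr, hbt⟩ := key _ _ (Or.inl hqe)
    refine ⟨b, Set.eq_singleton_iff_unique_mem.2 ⟨⟨_, _, Or.inl hqe, hb⟩, ?_⟩⟩
    rintro c ⟨f, p, hp, hc⟩
    obtain ⟨d, hd, hdr, hdt⟩ := key f p hp
    rw [hc.unique hd]
    exact hB t le_rfl _ _ (hdr.trans hbr.symm) hdt hbt
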